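/- Let $n\ge 1$, let $B_n$ be the open unit ball of $\mathbb C^n$ and $\sigma$ the normalized rotation invariant measure on $\partial B_n$. For $0<p<\infty$, the Hardy space $H^p$ consists of the holomorphic functions $f$ on $B_n$ with $\|f\|_p=\Big(\sup_{0<r<1}\int_{\partial B_n}|f(r\xi)|^p\,d\sigma(\xi)\Big)^{1/p}<\infty$. Let $\varphi:B_n\to B_n$ be a holomorphic map, $\psi$ a holomorphic function on $B_n$, and $W_{\psi,\varphi}f=\psi\cdot(f\circ\varphi)$. Write $g^*(\xi)=\lim_{r\to1^-}g(r\xi)$ for radial limits at $\xi\in\partial B_n$ (with the value $0$ where the limit does not exist), and let $E=\{\xi\in\partial B_n:|\varphi^*(\xi)|=1\}$. For $0<q<\infty$ let $\mu_{\psi,\varphi,q}$ be the Borel measure on $\overline{B}_n$ given by $$\mu_{\psi,\varphi,q}(A)=\int_{(\varphi^*)^{-1}(A)}|\psi^*|^q\,d\sigma .$$ If $0<p<q<\infty$ and $W_{\psi,\varphi}$ is bounded from $H^p$ to $H^q$ (that is, $W_{\psi,\varphi}$ maps $H^p$ into $H^q$ and there is a finite $C$ with $\|W_{\psi,\varphi}f\|_q\le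 C\|f\|_p$ for all $f\in H^p$), then $\mu_{\psi,\varphi,q}(\varphi^*(E))=0$. -/

import Mathlib

open MeasureTheory Set Filter Metric
open scoped ENNReal Topology

namespace HardyBall

/-- The space `ℂⁿ` with its Hermitian (Euclidean) norm. -/
abbrev Cn (n : ℕ) : Type := EuclideanSpace ℂ (Fin n)

/-- The open unit ball `B_n` of `ℂⁿ`. -/
abbrev unitBall (n : ℕ) : Set (Cn n) := ball (0 : Cn n) 1

/-- The unit sphere `∂B_n` of `ℂⁿ`. -/
abbrev unitSphere (n : ℕ) : Set (Cn n) := sphere (0 : Cn n) 1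

/-- The normalized rotation invariant measure on `∂B_n`: the surface measure induced by the
Lebesgue measure of `ℂⁿ`, divided by its total mass. -/
noncomputable def sigma (n : ℕ) : Measure (unitSphere n) :=
  ((volume : Measure (Cn n)).toSphere univ)⁻¹ • (volume : Measure (Cn n)).toSphere

/-- The Hardy (quasi-)norm `‖f‖_p = (sup_{0<r<1} ∫_{∂B_n} |f(rξ)|^p dσ(ξ))^{1/p}`, as an element
of `[0,∞]`. -/
noncomputable def hardyNorm {n : ℕ} (p : ℝ) (f : Cn n → ℂ) : ℝ≥0∞ :=
  (⨆ r ∈ Ioo (0 : ℝ) 1, ∫⁻ ξ : unitSphere n, ‖f (r • (ξ : Cn n))‖ₑ ^ p ∂(sigma n)) ^ (1 / p)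

/-- `f` belongs to the Hardy space `H^p(B_n)`: it is holomorphic on `B_n` with finite Hardy norm.
(Values of `f` outside `B_n` play no role.) -/
def MemHardy {n : ℕ} (p : ℝ) (f : Cn n → ℂ) : Prop :=
  DifferentiableOn ℂ f (unitBall n) ∧ hardyNorm p f < ∞

/-- The weighted composition operator `W_{ψ,φ} f = ψ · (f ∘ φ)`. -/
def weightedComp {n : ℕ} (ψ : Cn n → ℂ) (φ : Cn n → Cn n) (f : Cn n → ℂ) : Cn n → ℂ :=
  fun z => ψ z * f (φ z)

/-- `W_{ψ,φ}` is a bounded operator from `H^p` to `H^q`: it maps `H^p` into `H^q`, and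
`‖W_{ψ,φ} f‖_q ≤ C ‖f‖_p` for all `f ∈ H^p`, with a finite constant `C`. -/
def IsBoundedWeightedComp {n : ℕ} (p q : ℝ) (ψ : Cn n → ℂ) (φ : Cn n → Cn n) : Prop :=
  (∀ f : Cn n → ℂ, MemHardy p f → MemHardy q (weightedComp ψ φ f)) ∧
    ∃ C : NNReal, ∀ f : Cn n → ℂ, MemHardy p f →
      hardyNorm q (weightedComp ψ φ f) ≤ C * hardyNorm p f

open Classical in
/-- The radial limit `f^*(ξ) = lim_{r → 1⁻} f(rξ)` at a point `ξ` of the sphere; at the points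
where the limit does not exist (for Hardy functions, a set of `σ`-measure zero) the value is `0`. -/
noncomputable def radialLimit {n : ℕ} {F : Type} [TopologicalSpace F] [Zero F]
    (f : Cn n → F) (ξ : unitSphere n) : F :=
  if h : ∃ l : F, Tendsto (fun r : ℝ => f (r • (ξ : Cn n))) (𝓝[<] 1) (𝓝 l) then h.choose else 0

/-- The extreme set `E = {ξ ∈ ∂B_n : |φ^*(ξ)| = 1}` of `φ`. Points where `φ` has no radial limit
do not belong to it, since `φ^* = 0` there. -/
def extremeSet {n : ℕ} (φ : Cn n → Cn n) : Set (unitSphere n) :=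
  {ξ | ‖radialLimit φ ξ‖ = 1}

/-- The measure `μ_{ψ,φ,q}`, with `μ_{ψ,φ,q}(A) = ∫_{(φ^*)⁻¹(A)} |ψ^*|^q dσ` (see
`pullbackMeasure_apply`), as a Borel measure on `ℂⁿ`; it is carried by the closed unit ball. -/
noncomputable def pullbackMeasure {n : ℕ} (ψ : Cn n → ℂ) (φ : Cn n → Cn n) (q : ℝ) :
    Measure (Cn n) :=
  ((sigma n).withDensity (fun ξ => ‖radialLimit ψ ξ‖ₑ ^ q)).map (radialLimit φ)

/-- For a continuous function on an interval, a left limit at the end point may be tested along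
the rational points. -/
theorem tendsto_left_of_rat {F : Type} [TopologicalSpace F] [T3Space F] {g : ℝ → F} {l : F}
    (hg : ContinuousOn g (Ioo 0 1))
    (h : Tendsto (fun s : {s : ℚ // (s : ℝ) ∈ Ioo (0 : ℝ) 1} => g (s : ℚ))
      (comap (fun s : {s : ℚ // (s : ℝ) ∈ Ioo (0 : ℝ) 1} => ((s : ℚ) : ℝ)) (𝓝[<] 1)) (𝓝 l)) :
    Tendsto g (𝓝[<] 1) (𝓝 l) := by
  refine (closed_nhds_basis l).tendsto_right_iff.2 fun V hV => ?_
  have h1 := h hV.1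
  rw [mem_map, mem_comap] at h1
  obtain ⟨T, hT, hTV⟩ := h1
  obtain ⟨a, ha, haT⟩ := (mem_nhdsLT_iff_exists_Ioo_subset' (show (0 : ℝ) < 1 by norm_num)).1 hT
  have hmem : Ioo (max a 0) (1 : ℝ) ∈ 𝓝[<] (1 : ℝ) :=
    Ioo_mem_nhdsLT (max_lt ha (by norm_num))
  filter_upwards [hmem] with r hr
  have hr0 : r ∈ Ioo (0 : ℝ) 1 := ⟨(le_max_right _ _).trans_lt hr.1, hr.2⟩
  have hc : ContinuousAt g r := hg.continuousAt (Ioo_mem_nhds hr0.1 hr0.2)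
  by_contra hne
  have h2 : ∀ᶠ x in 𝓝 r, g x ∈ Vᶜ ∧ x ∈ Ioo (max a 0) (1 : ℝ) :=
    (hc.eventually (hV.2.isOpen_compl.mem_nhds hne)).and (Ioo_mem_nhds hr.1 hr.2)
  obtain ⟨U, hU, hUo, hrU⟩ := _root_.eventually_nhds_iff.1 h2
  obtain ⟨x, hxU, s, rfl⟩ := Rat.denseRange_cast.inter_open_nonempty U hUo ⟨r, hrU⟩
  have h3 := hU _ hxU
  exact h3.1 (hTV (show (⟨s, (le_max_right _ _).trans_lt h3.2.1, h3.2.2⟩ :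
    {s : ℚ // (s : ℝ) ∈ Ioo (0 : ℝ) 1}) ∈ _ from
      haT ⟨(le_max_left _ _).trans_lt h3.2.1, h3.2.2⟩))

/-- The radial limit of a function that is continuous on `B_n` is a Borel function. -/
theorem measurable_radialLimit {n : ℕ} {F : Type} [NormedAddCommGroup F] [CompleteSpace F]
    [SecondCountableTopology F] [MeasurableSpace F] [BorelSpace F] {f : Cn n → F}
    (hf : ContinuousOn f (unitBall n)) : Measurable (radialLimit f) := by
  classical
  have hball : ∀ (ξ : unitSphere n) (r : ℝ), r ∈ Ioo (0 : ℝ) 1 → r • (ξ : Cn n) ∈ unitBall n := by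
    intro ξ r hr
    have hξ : ‖(ξ : Cn n)‖ = 1 := by simp
    simpa [norm_smul, abs_of_pos hr.1] using hr.2
  let I := {s : ℚ // (s : ℝ) ∈ Ioo (0 : ℝ) 1}
  let L : Filter I := comap (fun s : I => ((s : ℚ) : ℝ)) (𝓝[<] 1)
  let u : I → unitSphere n → F := fun s ξ => f (((s : ℚ) : ℝ) • (ξ : Cn n))
  have hu : ∀ s, Measurable (u s) := by
    intro s
    refine Continuous.measurable ?_
    exact hf.comp_continuous (by fun_prop) (fun ξ => hball ξ _ s.2)
  have : L.NeBot := by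
    refine comap_neBot fun T hT => ?_
    obtain ⟨a, ha, haT⟩ := (mem_nhdsLT_iff_exists_Ioo_subset' (show (0 : ℝ) < 1 by norm_num)).1 hT
    obtain ⟨s, hs1, hs2⟩ := exists_rat_btwn (max_lt ha (show (0 : ℝ) < 1 by norm_num))
    exact ⟨⟨s, (le_max_right _ _).trans_lt hs1, hs2⟩, haT ⟨(le_max_left _ _).trans_lt hs1, hs2⟩⟩
  have hL : Tendsto (fun s : I => ((s : ℚ) : ℝ)) L (𝓝[<] 1) := tendsto_comap
  have hcont : ∀ ξ : unitSphere n,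
      ContinuousOn (fun r : ℝ => f (r • (ξ : Cn n))) (Ioo (0 : ℝ) 1) := fun ξ =>
    hf.comp (by fun_prop) (fun r hr => hball ξ r hr)
  let A : Set (unitSphere n) := {ξ | ∃ l, Tendsto (fun s => u s ξ) L (𝓝 l)}
  have hA : MeasurableSet A := measurableSet_exists_tendsto hu
  refine measurable_of_tendsto_metrizable' L (fun s => (hu s).indicator hA)
    (tendsto_pi_nhds.2 fun ξ => ?_)
  by_cases hξ : ξ ∈ A
  · obtain ⟨l, hl⟩ := hξ
    have hex : ∃ l : F, Tendsto (fun r : ℝ => f (r • (ξ : Cn n))) (𝓝[<] 1) (𝓝 l) :=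
      ⟨l, tendsto_left_of_rat (hcont ξ) hl⟩
    have h1 : radialLimit f ξ = hex.choose := dif_pos hex
    have h2 : ∀ s, A.indicator (u s) ξ = u s ξ := fun s =>
      indicator_of_mem (show ξ ∈ A from ⟨l, hl⟩) _
    simp only [h2, h1]
    exact hex.choose_spec.comp hL
  · have hex : ¬ ∃ l : F, Tendsto (fun r : ℝ => f (r • (ξ : Cn n))) (𝓝[<] 1) (𝓝 l) :=
      fun ⟨l, hl⟩ => hξ ⟨l, hl.comp hL⟩
    have h1 : radialLimit f ξ = 0 := dif_neg hex
    have h2 : ∀ s, A.indicator (u s) ξ = 0 := fun s => indicator_of_notMem hξ _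
    simp only [h2, h1]
    exact tendsto_const_nhds

/-- The defining formula of `μ_{ψ,φ,q}` on Borel sets. -/
theorem pullbackMeasure_apply {n : ℕ} {ψ : Cn n → ℂ} {φ : Cn n → Cn n} (q : ℝ)
    (hφ : ContinuousOn φ (unitBall n)) {A : Set (Cn n)} (hA : MeasurableSet A) :
    pullbackMeasure ψ φ q A =
      ∫⁻ ξ in radialLimit φ ⁻¹' A, ‖radialLimit ψ ξ‖ₑ ^ q ∂(sigma n) := by
  have hm : Measurable (radialLimit φ) := measurable_radialLimit hφ
  rw [pullbackMeasure, Measure.map_apply hm hA, withDensity_apply _ (hm hA)]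

end HardyBall

namespace HardyBall

/-! Test the operator on the powers `(1 - r⟨ζ, z⟩)^(-s/p)` with `|ζ| = 1` and `r < 1`. If `|1 - ⟨ζ,
ξ⟩|^(-s)` is integrable over the sphere, their `H^p` norms are bounded uniformly in `r` and `ζ`
(`hardyNorm_kernelPower_le`). Boundedness and Fatou then bound the integral over `E` of `|ψ*|^q |1 -
r⟨ζ, φ*⟩|^(-sq/p)` by a constant (`lintegral_extremeSet_le`). Integrate this in `ζ` and apply
Tonelli. On `E` the point `φ*(ξ)` lies on the sphere, so by unitary invariance the inner integral
`I(r)` does not depend on `ξ`. Hence `(∫_E |ψ*|^q) * I(r)` stays bounded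
(`lintegral_mul_lintegral_kernelPower_le`). Since `q/p > 1`, `s` can be chosen so that `|1 - ⟨ζ,
ξ⟩|^(-s)` is integrable but its power `q/p` is not (`exists_critical_exponent`). Letting `r → 1`
then forces `∫_E |ψ*|^q = 0`. -/

/-! ### Unitary invariance of the measure on the sphere. -/

instance isFiniteMeasure_sigma (n : ℕ) [NeZero n] : IsFiniteMeasure (sigma n) := by
  refine ⟨?_⟩
  rw [sigma, Measure.smul_apply, smul_eq_mul]
  refine ENNReal.mul_lt_top (ENNReal.inv_lt_top.2 ?_) (measure_lt_top _ _)
  exact pos_iff_ne_zero.2 (Measure.measure_univ_ne_zero.2 (Measure.toSphere_ne_zero _))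

/-- The action of a unitary map on the unit sphere. -/
noncomputable def sphereMap {n : ℕ} (e : Cn n ≃ₗᵢ[ℂ] Cn n) (ξ : unitSphere n) : unitSphere n :=
  ⟨e ξ, by simp⟩

theorem continuous_sphereMap {n : ℕ} (e : Cn n ≃ₗᵢ[ℂ] Cn n) : Continuous (sphereMap e) :=
  (e.continuous.comp continuous_subtype_val).subtype_mk _

open scoped Pointwise in
/-- Unitary maps preserve the normalized measure of the sphere. -/
theorem measurePreserving_sphereMap {n : ℕ} (e : Cn n ≃ₗᵢ[ℂ] Cn n) :
    MeasurePreserving (sphereMap e) (sigma n) (sigma n) := by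
  have key : MeasurePreserving (sphereMap e) (volume : Measure (Cn n)).toSphere
      (volume : Measure (Cn n)).toSphere := by
    refine ⟨(continuous_sphereMap e).measurable, Measure.ext fun s hs => ?_⟩
    have hs' := (continuous_sphereMap e).measurable hs
    rw [Measure.map_apply (continuous_sphereMap e).measurable hs, Measure.toSphere_apply' _ hs,
      Measure.toSphere_apply' _ hs']
    congr 1
    -- The surface measure of a set is a multiple of the volume of the cone over it, so it is enough
    -- that `e`, as a real isometry, preserves Lebesgue measure.
    let eR : Cn n ≃ₗᵢ[ℝ] Cn n := { e.toLinearEquiv.restrictScalars ℝ with norm_map' := e.norm_map }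
    have hpre : Ioo (0 : ℝ) 1 • ((↑) '' (sphereMap e ⁻¹' s) : Set (Cn n)) =
        eR ⁻¹' (Ioo (0 : ℝ) 1 • ((↑) '' s : Set (Cn n))) := by
      ext z
      simp only [Set.mem_smul, mem_preimage]
      constructor
      · rintro ⟨r, hr, _, ⟨ξ, hξ, rfl⟩, rfl⟩
        exact ⟨r, hr, _, ⟨_, hξ, rfl⟩, (eR.map_smul r (ξ : Cn n)).symm⟩
      · rintro ⟨r, hr, _, ⟨ξ, hξ, rfl⟩, h⟩
        have hξ' : sphereMap e ⟨eR.symm ξ, by simp⟩ = ξ := Subtype.ext (eR.apply_symm_apply _)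
        refine ⟨r, hr, eR.symm ξ, ⟨⟨eR.symm ξ, by simp⟩, ?_, rfl⟩, ?_⟩
        · rwa [mem_preimage, hξ']
        · exact (eR.symm.map_smul r (ξ : Cn n)).symm.trans
            ((congrArg eR.symm h).trans (eR.symm_apply_apply z))
    rw [hpre]
    exact eR.measurePreserving.measure_preimage_equiv (f := eR.toMeasurableEquiv) _
  exact key.smul_measure _

/-- The unitary group acts transitively on the unit sphere. -/
theorem exists_sphereMap_eq {n : ℕ} [NeZero n] (ζ η : unitSphere n) :
    ∃ e : Cn n ≃ₗᵢ[ℂ] Cn n, e ζ = η := by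
  have key : ∀ x : unitSphere n, ∃ b : OrthonormalBasis (Fin n) ℂ (Cn n), b 0 = x := by
    intro x
    have hx : ‖(x : Cn n)‖ = 1 := by simp
    obtain ⟨b, hb⟩ := Orthonormal.exists_orthonormalBasis_extension_of_card_eq (𝕜 := ℂ)
      (ι := Fin n) (E := Cn n) (by simp) (v := fun _ => (x : Cn n)) (s := {0})
      ⟨fun _ => hx, fun i j hij => (hij (Subsingleton.elim i j)).elim⟩
    exact ⟨b, hb 0 rfl⟩
  obtain ⟨b, hb⟩ := key ζ
  obtain ⟨c, hc⟩ := key η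
  exact ⟨b.equiv c (Equiv.refl _), by rw [← hb, ← hc]; simp⟩

/-- The distribution of `⟨ζ, ξ⟩` under the normalized measure does not depend on `ζ`. -/
theorem lintegral_inner_eq {n : ℕ} [NeZero n] {F : ℂ → ℝ≥0∞} (hF : Measurable F)
    (ζ η : unitSphere n) :
    ∫⁻ ξ : unitSphere n, F (inner ℂ (ζ : Cn n) ξ) ∂(sigma n) =
      ∫⁻ ξ : unitSphere n, F (inner ℂ (η : Cn n) ξ) ∂(sigma n) := by
  obtain ⟨e, he⟩ := exists_sphereMap_eq ζ η
  have hm : Measurable fun ξ : unitSphere n => F (inner ℂ (η : Cn n) (ξ : Cn n)) :=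
    hF.comp (Continuous.measurable (by fun_prop))
  rw [← (measurePreserving_sphereMap e).lintegral_comp hm]
  refine lintegral_congr fun ξ => ?_
  rw [← he, sphereMap, e.inner_map_map]

/-! ### Measure of the caps `{|1 - ⟨ζ, ξ⟩| < t}`. -/

/-- The slab `{|Im ⟨ζ, z⟩| < 1 / (2N)}` of the unit ball has volume `O(1 / N)`. -/
theorem mul_volume_slab_le {n : ℕ} (ζ : unitSphere n) {N : ℕ} (hN : 0 < N) :
    (N : ℝ≥0∞) * volume {z : Cn n | z ∈ unitBall n ∧ |(inner ℂ (ζ : Cn n) z).im| < 1 / (2 * N)} ≤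
      volume (ball (0 : Cn n) 2) := by
  set S := {z : Cn n | z ∈ unitBall n ∧ |(inner ℂ (ζ : Cn n) z).im| < 1 / (2 * N)}
  have hζ : ‖(ζ : Cn n)‖ = 1 := by simp
  have hN' : (0 : ℝ) < N := by exact_mod_cast hN
  have hS : MeasurableSet S := by
    refine IsOpen.measurableSet ?_
    have h : IsOpen {z : Cn n | |(inner ℂ (ζ : Cn n) z).im| < 1 / (2 * N)} :=
      isOpen_lt (by fun_prop) continuous_const
    exact isOpen_ball.inter h
  -- Translating by multiples of `iζ / N` shifts `Im ⟨ζ, z⟩` by multiples of `1 / N`, the width of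
  -- the slab: `N` disjoint copies fit into the ball of radius 2.
  let v : ℕ → Cn n := fun k => ((k / N : ℝ) * Complex.I : ℂ) • (ζ : Cn n)
  have hv : ∀ k, (inner ℂ (ζ : Cn n) (v k)).im = k / N := by
    intro k
    simp only [v, inner_smul_right, inner_self_eq_norm_sq_to_K, hζ]
    simp
  have hdisj : Set.Pairwise (Finset.range N : Set ℕ)
      (Function.onFun Disjoint fun k => (fun z => z + v k) ⁻¹' S) := by
    intro j _ k _ hjk
    refine Set.disjoint_left.2 fun z hz hz' => hjk ?_
    have h1 := abs_lt.1 hz.2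
    have h2 := abs_lt.1 hz'.2
    simp only [inner_add_right, Complex.add_im, hv] at h1 h2
    have e1 : (1 : ℝ) / (2 * N) = 1 / 2 / N := by field_simp
    have h3 : ((j : ℝ) - k) / N < 1 / N := by
      have : (1 : ℝ) / N = 1 / 2 / N + 1 / 2 / N := by field_simp; norm_num
      rw [sub_div]; linarith
    have h4 : ((k : ℝ) - j) / N < 1 / N := by
      have : (1 : ℝ) / N = 1 / 2 / N + 1 / 2 / N := by field_simp; norm_num
      rw [sub_div]; linarith
    rw [div_lt_div_iff_of_pos_right hN'] at h3 h4
    have h5 : (j : ℝ) < k + 1 := by linarith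
    have h6 : (k : ℝ) < j + 1 := by linarith
    norm_cast at h5 h6
    omega
  calc (N : ℝ≥0∞) * volume S = ∑ k ∈ Finset.range N, volume ((fun z => z + v k) ⁻¹' S) := by
        simp [measure_preimage_add_right]
    _ = volume (⋃ k ∈ Finset.range N, (fun z => z + v k) ⁻¹' S) :=
        (measure_biUnion_finset hdisj fun k _ => (measurable_add_const _) hS).symm
    _ ≤ volume (ball (0 : Cn n) 2) := by
        refine measure_mono (iUnion₂_subset fun k hk z hz => ?_)
        have h1 : ‖z + v k‖ < 1 := by simpa using hz.1
        have h2 : ‖v k‖ < 1 := by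
          have : (k : ℝ) < N := by exact_mod_cast Finset.mem_range.1 hk
          simp only [v, norm_smul, hζ]
          simpa [div_lt_one hN'] using this
        have h3 := norm_sub_le (z + v k) (v k)
        rw [add_sub_cancel_right] at h3
        simp only [mem_ball, dist_zero_right]
        linarith

open scoped Pointwise in
/-- The cap `{|1 - ⟨ζ, ξ⟩| < 1 / (2N)}` of the sphere has measure `O(1 / N)`. -/
theorem exists_sigma_cap_le (n : ℕ) [NeZero n] : ∃ C : ℝ≥0∞, C ≠ ∞ ∧ ∀ (ζ : unitSphere n) (N : ℕ),
    0 < N → sigma n {ξ : unitSphere n | ‖1 - inner ℂ (ζ : Cn n) (ξ : Cn n)‖ < 1 / (2 * N)} ≤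
      C / N := by
  set c : ℝ≥0∞ := ((volume : Measure (Cn n)).toSphere univ)⁻¹ with hc
  have hct : c ≠ ∞ := ENNReal.inv_ne_top.2
    (Measure.measure_univ_ne_zero.2 (Measure.toSphere_ne_zero _))
  refine ⟨c * (Module.finrank ℝ (Cn n) * volume (ball (0 : Cn n) 2)), ?_, fun ζ N hN => ?_⟩
  · exact ENNReal.mul_ne_top hct (ENNReal.mul_ne_top (by simp) measure_ball_lt_top.ne)
  set T := {ξ : unitSphere n | ‖1 - inner ℂ (ζ : Cn n) (ξ : Cn n)‖ < 1 / (2 * N)}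
  have hT : MeasurableSet T := IsOpen.measurableSet
    (isOpen_lt (by fun_prop) continuous_const)
  -- On the cone, `|Im ⟨ζ, rξ⟩| ≤ |Im ⟨ζ, ξ⟩| ≤ |1 - ⟨ζ, ξ⟩|`. The resulting bound is crude, but one
  -- integrable exponent is all that is needed.
  have hcone : Ioo (0 : ℝ) 1 • ((↑) '' T : Set (Cn n)) ⊆
      {z : Cn n | z ∈ unitBall n ∧ |(inner ℂ (ζ : Cn n) z).im| < 1 / (2 * N)} := by
    rintro _ ⟨r, hr, _, ⟨ξ, hξ, rfl⟩, rfl⟩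
    have hr' := hr.2
    refine ⟨by simpa [norm_smul, abs_of_pos hr.1] using hr.2, ?_⟩
    have h1 := Complex.abs_im_le_norm (1 - inner ℂ (ζ : Cn n) (ξ : Cn n))
    have h2 : ‖1 - inner ℂ (ζ : Cn n) (ξ : Cn n)‖ < 1 / (2 * N) := hξ
    simp only [Complex.sub_im, Complex.one_im, zero_sub, abs_neg] at h1
    have h3 : inner ℂ (ζ : Cn n) (r • (ξ : Cn n)) = (r : ℂ) * inner ℂ (ζ : Cn n) (ξ : Cn n) := by
      rw [← inner_smul_right]; rfl
    simp only [h3, Complex.im_ofReal_mul, abs_mul, abs_of_pos hr.1]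
    have := abs_nonneg (inner ℂ (ζ : Cn n) (ξ : Cn n)).im
    nlinarith
  rw [ENNReal.le_div_iff_mul_le (by simp [hN.ne']) (by simp)]
  rw [sigma, Measure.smul_apply, smul_eq_mul, Measure.toSphere_apply' _ hT]
  calc c * (Module.finrank ℝ (Cn n) * volume (Ioo (0 : ℝ) 1 • ((↑) '' T : Set (Cn n)))) * N
      = c * (Module.finrank ℝ (Cn n) *
        (N * volume (Ioo (0 : ℝ) 1 • ((↑) '' T : Set (Cn n))))) := by ring
    _ ≤ _ := by
        gcongr
        exact (mul_le_mul_right (measure_mono hcone) _).trans (mul_volume_slab_le ζ hN)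

/-- The cap `{|1 - ⟨ζ, ξ⟩| < t}` of the sphere has measure at least a multiple of a power
of `t`. -/
theorem exists_le_sigma_cap (n : ℕ) [NeZero n] : ∃ c : ℝ≥0∞, c ≠ 0 ∧ ∃ d : ℕ,
    ∀ (ζ : unitSphere n) (t : ℝ), 0 < t → t ≤ 1 →
      c * ENNReal.ofReal t ^ d ≤
        sigma n {ξ : unitSphere n | ‖1 - inner ℂ (ζ : Cn n) (ξ : Cn n)‖ < t} := by
  set d := Module.finrank ℝ (Cn n)
  have hd : d ≠ 0 := Module.finrank_pos.ne'
  set a : ℝ≥0∞ := ((volume : Measure (Cn n)).toSphere univ)⁻¹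
  have ha : a ≠ 0 := ENNReal.inv_ne_zero.2 (measure_ne_top _ _)
  have hb : volume (ball (0 : Cn n) 1) ≠ 0 := (measure_ball_pos _ _ one_pos).ne'
  refine ⟨a * (d * (1 / 4) ^ d * volume (ball (0 : Cn n) 1)), ?_, d, fun ζ t ht ht1 => ?_⟩
  · refine mul_ne_zero ha (mul_ne_zero (mul_ne_zero (by simpa using hd) ?_) hb)
    exact pow_ne_zero _ (by simp)
  have h1 := (volume : Measure (Cn n)).toSphereBallBound_mul_measure_unitBall_le_toSphere_ball
    ht ζ
  have h2 : (Measure.toSphereBallBound d t : ℝ≥0∞) = d * (1 / 4) ^ d * ENNReal.ofReal t ^ d := by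
    have : min t.toNNReal 2 = t.toNNReal :=
      min_eq_left (by rw [Real.toNNReal_le_iff_le_coe]; norm_num; linarith)
    rw [Measure.toSphereBallBound, if_pos ⟨hd, ht⟩, this, ENNReal.ofReal]
    rw [mul_assoc, ← mul_pow]
    push_cast
    congr 2
    rw [mul_comm, mul_one_div]
  rw [sigma, Measure.smul_apply, smul_eq_mul]
  calc a * (d * (1 / 4) ^ d * volume (ball (0 : Cn n) 1)) * ENNReal.ofReal t ^ d
      = a * (Measure.toSphereBallBound d t * volume (ball (0 : Cn n) 1)) := by rw [h2]; ring
    _ ≤ _ := by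
      gcongr
      -- The Euclidean ball of radius `t` about `ζ` lies in the cap, because `1 - ⟨ζ, ξ⟩ = ⟨ζ, ζ -
      -- ξ⟩`.
      refine h1.trans (measure_mono fun ξ hξ => ?_)
      have hζ : ‖(ζ : Cn n)‖ = 1 := by simp
      have h3 : (1 : ℂ) - inner ℂ (ζ : Cn n) (ξ : Cn n) =
          inner ℂ (ζ : Cn n) ((ζ : Cn n) - ξ) := by
        rw [inner_sub_right, inner_self_eq_norm_sq_to_K, hζ]; simp
      have h4 : ‖(ζ : Cn n) - ξ‖ < t := by
        rw [← dist_eq_norm, dist_comm]; exact hξ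
      have h5 := norm_inner_le_norm (𝕜 := ℂ) (ζ : Cn n) ((ζ : Cn n) - ξ)
      rw [hζ, one_mul] at h5
      change ‖_‖ < t
      rw [h3]
      exact h5.trans_lt h4

/-! ### Integrability of powers of `|1 - ⟨ζ, ξ⟩|`. -/

theorem measurable_enorm_one_sub_inner_rpow {n : ℕ} (ζ : Cn n) (s : ℝ) :
    Measurable fun ξ : unitSphere n => ‖1 - inner ℂ ζ (ξ : Cn n)‖ₑ ^ s :=
  (Continuous.measurable (by fun_prop)).pow_const s

/-- Dyadic decomposition of `x ↦ x ^ (-1/2)`. -/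
theorem enorm_rpow_neg_half_le (w : ℂ) :
    ‖w‖ₑ ^ (-(1 / 2) : ℝ) ≤ 4 * (1 + ∑' k : ℕ,
      {u : ℂ | ‖u‖ < 1 / (2 * (4 ^ k : ℕ))}.indicator (fun _ => (2 : ℝ≥0∞) ^ k) w) := by
  have hle : ∀ k : ℕ, ‖w‖ < 1 / (2 * (4 ^ k : ℕ)) → (2 : ℝ≥0∞) ^ k ≤ ∑' k : ℕ,
      {u : ℂ | ‖u‖ < 1 / (2 * (4 ^ k : ℕ))}.indicator (fun _ => (2 : ℝ≥0∞) ^ k) w := by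
    intro k hk
    refine le_trans ?_ (ENNReal.le_tsum k)
    rw [indicator_of_mem (by exact hk)]
  -- At `w = 0` the left side is `∞`, and every term `2 ^ k` of the series is present.
  rcases eq_or_ne w 0 with rfl | hw
  · have : ∑' k : ℕ, {u : ℂ | ‖u‖ < 1 / (2 * (4 ^ k : ℕ))}.indicator
        (fun _ => (2 : ℝ≥0∞) ^ k) 0 = ∞ := by
      refine ENNReal.eq_top_of_forall_nnreal_le fun r => ?_
      obtain ⟨k, hk⟩ := exists_nat_gt r
      have h1 : (r : ℝ≥0∞) ≤ k := by exact_mod_cast hk.le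
      have h2 : (k : ℝ≥0∞) ≤ 2 ^ k := by exact_mod_cast Nat.lt_two_pow_self.le
      exact (h1.trans h2).trans (hle k (by simp))
    rw [this, add_top, ENNReal.mul_top (by norm_num)]
    exact le_top
  have hw' : 0 < ‖w‖ := norm_pos_iff.2 hw
  -- The hypothesis gives `‖w‖^(-1/2) ≤ √2 * 2 ^ (k + 1)`, whence the constant 4.
  have bound : ∀ k : ℕ, 1 / (2 * 4 ^ (k + 1)) ≤ ‖w‖ → ‖w‖ₑ ^ (-(1 / 2) : ℝ) ≤ 4 * 2 ^ k := by
    intro k hk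
    rw [ENNReal.rpow_neg, ENNReal.inv_le_iff_inv_le]
    have h1 : ENNReal.ofReal (1 / (4 * 2 ^ k)) ≤ ‖w‖ₑ ^ (1 / 2 : ℝ) := by
      rw [← ofReal_norm, ENNReal.ofReal_rpow_of_pos hw']
      refine ENNReal.ofReal_le_ofReal ?_
      rw [← Real.sqrt_eq_rpow]
      refine Real.le_sqrt_of_sq_le (le_trans ?_ hk)
      rw [div_pow, one_pow, mul_pow, ← pow_mul, mul_comm k 2, pow_mul, pow_succ]
      norm_num [pow_succ]
      have : (0 : ℝ) < (4 ^ k)⁻¹ := by positivity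
      nlinarith
    refine le_trans (le_of_eq ?_) h1
    rw [ENNReal.ofReal_div_of_pos (by positivity), ENNReal.ofReal_mul (by norm_num),
      ENNReal.ofReal_pow (by norm_num)]
    simp
  by_cases h2 : ‖w‖ < 1 / 2
  · obtain ⟨k, hk1, hk2⟩ := exists_nat_pow_near (x := 1 / (2 * ‖w‖)) (y := (4 : ℝ))
      (by rw [le_div_iff₀ (by positivity)]; linarith) (by norm_num)
    rw [le_div_iff₀ (by positivity)] at hk1
    rw [div_lt_iff₀ (by positivity)] at hk2
    rcases hk1.lt_or_eq with hk1 | hk1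
    · refine (bound k ?_).trans ?_
      · rw [div_le_iff₀ (by positivity)]; nlinarith
      · gcongr
        refine le_trans (hle k ?_) le_add_self
        rw [lt_div_iff₀ (by positivity)]
        push_cast
        nlinarith
    -- When `4 ^ k * (2‖w‖) = 1`, `w` lies on the boundary of the `k`-th open disc, and the previous
    -- scale is used instead.
    · obtain _ | k := k
      · simp at hk1; linarith
      refine (bound k ?_).trans ?_
      · rw [div_le_iff₀ (by positivity)]; nlinarith
      · gcongr
        refine le_trans (hle k ?_) le_add_self
        rw [lt_div_iff₀ (by positivity)]
        push_cast
        rw [pow_succ] at hk1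
        have : 0 < 4 ^ k * (2 * ‖w‖) := by positivity
        nlinarith
  · refine (bound 0 ?_).trans ?_
    · norm_num at h2 ⊢; linarith
    · gcongr
      simp

/-- The `k`-th dyadic term has weight `2 ^ k` on a cap of measure at most `C / 4 ^ k`, so the series
is dominated by a geometric one. -/
theorem lintegral_rpow_neg_half_lt_top {n : ℕ} [NeZero n] (ζ : unitSphere n) :
    ∫⁻ ξ : unitSphere n, ‖1 - inner ℂ (ζ : Cn n) (ξ : Cn n)‖ₑ ^ (-(1 / 2) : ℝ) ∂(sigma n) < ∞ := by
  obtain ⟨C, hC, hcap⟩ := exists_sigma_cap_le n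
  let g : unitSphere n → ℂ := fun ξ => 1 - inner ℂ (ζ : Cn n) (ξ : Cn n)
  have hg : Measurable g := Continuous.measurable (by fun_prop)
  have hms : ∀ k : ℕ, MeasurableSet {u : ℂ | ‖u‖ < 1 / (2 * (4 ^ k : ℕ))} := fun k =>
    (isOpen_lt continuous_norm continuous_const).measurableSet
  have hm : ∀ k : ℕ, Measurable fun ξ => {u : ℂ | ‖u‖ < 1 / (2 * (4 ^ k : ℕ))}.indicator
      (fun _ => (2 : ℝ≥0∞) ^ k) (g ξ) := fun k =>
    (measurable_const.indicator (hms k)).comp hg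
  have hterm : ∀ k : ℕ, ∫⁻ ξ, {u : ℂ | ‖u‖ < 1 / (2 * (4 ^ k : ℕ))}.indicator
      (fun _ => (2 : ℝ≥0∞) ^ k) (g ξ) ∂(sigma n) ≤ C * (2⁻¹ : ℝ≥0∞) ^ k := by
    intro k
    have h1 : ∀ ξ, {u : ℂ | ‖u‖ < 1 / (2 * (4 ^ k : ℕ))}.indicator (fun _ => (2 : ℝ≥0∞) ^ k) (g ξ)
        = (g ⁻¹' {u : ℂ | ‖u‖ < 1 / (2 * (4 ^ k : ℕ))}).indicator (fun _ => (2 : ℝ≥0∞) ^ k) ξ :=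
      fun ξ => rfl
    simp_rw [h1]
    rw [lintegral_indicator_const (hg (hms k))]
    refine (mul_le_mul_right (hcap ζ (4 ^ k) (by positivity)) _).trans (le_of_eq ?_)
    have h4 : ((4 ^ k : ℕ) : ℝ≥0∞) = 2 ^ k * 2 ^ k := by
      rw [← mul_pow]; norm_num
    rw [h4, div_eq_mul_inv, ENNReal.mul_inv (by simp) (by simp), ← ENNReal.inv_pow]
    rw [mul_left_comm, ← mul_assoc (2 ^ k), ENNReal.mul_inv_cancel (by simp) (by simp), one_mul]
  calc ∫⁻ ξ : unitSphere n, ‖g ξ‖ₑ ^ (-(1 / 2) : ℝ) ∂(sigma n)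
      ≤ ∫⁻ ξ, 4 * (1 + ∑' k : ℕ, {u : ℂ | ‖u‖ < 1 / (2 * (4 ^ k : ℕ))}.indicator
          (fun _ => (2 : ℝ≥0∞) ^ k) (g ξ)) ∂(sigma n) :=
        lintegral_mono fun ξ => enorm_rpow_neg_half_le (g ξ)
    _ = 4 * (sigma n univ + ∑' k : ℕ, ∫⁻ ξ, {u : ℂ | ‖u‖ < 1 / (2 * (4 ^ k : ℕ))}.indicator
          (fun _ => (2 : ℝ≥0∞) ^ k) (g ξ) ∂(sigma n)) := by
        rw [lintegral_const_mul' _ _ (by norm_num), lintegral_add_left measurable_const,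
          lintegral_tsum fun k => (hm k).aemeasurable]
        simp
    _ ≤ 4 * (sigma n univ + ∑' k : ℕ, C * (2⁻¹ : ℝ≥0∞) ^ k) := by
        gcongr with k
        exact hterm k
    _ < ∞ := by
        rw [ENNReal.tsum_mul_left, ENNReal.tsum_geometric]
        refine ENNReal.mul_lt_top (by norm_num) (ENNReal.add_lt_top.2 ⟨measure_lt_top _ _, ?_⟩)
        refine ENNReal.mul_lt_top hC.lt_top ?_
        simp

/-- By Markov on the cap of radius `1 / m`, the integrand is at least `m ^ (d + 1)` on a set of
measure at least `c / m ^ d`; the integral therefore exceeds `c * m` for every `m`. -/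
theorem exists_lintegral_rpow_eq_top (n : ℕ) [NeZero n] : ∃ M : ℝ, ∀ (ζ : unitSphere n) (s : ℝ),
    M ≤ s →
      ∫⁻ ξ : unitSphere n, ‖1 - inner ℂ (ζ : Cn n) (ξ : Cn n)‖ₑ ^ (-s) ∂(sigma n) = ∞ := by
  obtain ⟨c, hc, d, hcap⟩ := exists_le_sigma_cap n
  refine ⟨d + 1, fun ζ s hs => ?_⟩
  have hs0 : 0 ≤ s := le_trans (by positivity) hs
  set I := ∫⁻ ξ : unitSphere n, ‖1 - inner ℂ (ζ : Cn n) (ξ : Cn n)‖ₑ ^ (-s) ∂(sigma n)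
  have key : ∀ k : ℕ, c * (k + 1 : ℕ) ≤ I := by
    intro k
    set m : ℝ≥0∞ := ((k + 1 : ℕ) : ℝ≥0∞) with hm
    have hm0 : m ≠ 0 := by simp [hm]
    have hmt : m ≠ ∞ := by simp only [hm, ne_eq, ENNReal.natCast_ne_top, not_false_eq_true]
    have hm1 : 1 ≤ m := by simp only [hm]; exact_mod_cast Nat.succ_pos k
    have ht : ENNReal.ofReal (1 / ((k + 1 : ℕ) : ℝ)) = m⁻¹ := by
      rw [one_div, ENNReal.ofReal_inv_of_pos (by positivity), ENNReal.ofReal_natCast]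
    have h1 := hcap ζ (1 / ((k + 1 : ℕ) : ℝ)) (by positivity)
      (by rw [div_le_one (by positivity)]; exact_mod_cast Nat.succ_pos k)
    rw [ht] at h1
    calc c * m = m ^ (d + 1) * (c * m⁻¹ ^ d) := by
          rw [pow_succ, ← ENNReal.inv_pow, mul_assoc, mul_left_comm m c, mul_left_comm (m ^ d) c,
            mul_left_comm (m ^ d) m, ENNReal.mul_inv_cancel (pow_ne_zero _ hm0)
            (ENNReal.pow_ne_top hmt), mul_one]
      _ ≤ m ^ (d + 1) * sigma n {ξ : unitSphere n |
            m ^ (d + 1) ≤ ‖1 - inner ℂ (ζ : Cn n) (ξ : Cn n)‖ₑ ^ (-s)} := by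
          gcongr
          refine h1.trans (measure_mono fun ξ hξ => ?_)
          have h2 : ‖1 - inner ℂ (ζ : Cn n) (ξ : Cn n)‖ₑ ≤ m⁻¹ := by
            rw [← ht, ← ofReal_norm]
            exact ENNReal.ofReal_le_ofReal (le_of_lt hξ)
          have h3 : m ≤ ‖1 - inner ℂ (ζ : Cn n) (ξ : Cn n)‖ₑ⁻¹ := ENNReal.le_inv_iff_le_inv.2 h2
          change m ^ (d + 1) ≤ ‖1 - inner ℂ (ζ : Cn n) (ξ : Cn n)‖ₑ ^ (-s)
          rw [ENNReal.rpow_neg, ← ENNReal.inv_rpow]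
          refine le_trans ?_ (ENNReal.rpow_le_rpow h3 hs0)
          rw [← ENNReal.rpow_natCast]
          exact ENNReal.rpow_le_rpow_of_exponent_le hm1 (by exact_mod_cast hs)
      _ ≤ I := mul_meas_ge_le_lintegral (measurable_enorm_one_sub_inner_rpow _ _) _
  by_contra hI
  obtain ⟨k, hk⟩ := ENNReal.exists_nat_gt (ENNReal.div_ne_top hI hc)
  refine absurd (key k) (not_le.2 ?_)
  rw [mul_comm]
  have hct : c ≠ ∞ := by
    rintro rfl
    have := key 0
    simp [hI] at this
  rw [ENNReal.div_lt_iff (Or.inl hc) (Or.inl hct)] at hk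
  refine hk.trans_le ?_
  gcongr
  exact Nat.le_succ k

/-- For `p < q` there is an exponent `s` for which `|1 - ⟨ζ, ξ⟩|⁻ˢ` is integrable over the sphere,
while its power with exponent `q / p` is not. -/
theorem exists_critical_exponent (n : ℕ) [NeZero n] {p q : ℝ} (hp : 0 < p) (hpq : p < q) :
    ∃ s : ℝ, 0 < s ∧ ∀ ζ : unitSphere n,
      ∫⁻ ξ : unitSphere n, ‖1 - inner ℂ (ζ : Cn n) (ξ : Cn n)‖ₑ ^ (-s) ∂(sigma n) < ∞ ∧
      ∫⁻ ξ : unitSphere n, ‖1 - inner ℂ (ζ : Cn n) (ξ : Cn n)‖ₑ ^ (-(s * (q / p))) ∂(sigma n) =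
        ∞ := by
  obtain ⟨M, hM⟩ := exists_lintegral_rpow_eq_top n
  let e : unitSphere n := ⟨EuclideanSpace.single 0 1, by simp⟩
  -- The value of `sSup S` is not needed: any `s ∈ S` above `sSup S / (q / p)` works, since
  -- multiplying it by `q / p` overshoots the supremum.
  let S : Set ℝ := {s | ∫⁻ ξ : unitSphere n, ‖1 - inner ℂ (e : Cn n) (ξ : Cn n)‖ₑ ^ (-s)
    ∂(sigma n) < ∞}
  have hS : (1 / 2 : ℝ) ∈ S := lintegral_rpow_neg_half_lt_top e
  have hbdd : BddAbove S := ⟨M, fun s hs => by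
    by_contra h
    exact absurd (hM e s (not_le.1 h).le) hs.ne⟩
  have hsup : (1 / 2 : ℝ) ≤ sSup S := le_csSup hbdd hS
  have hq : 1 < q / p := by rwa [one_lt_div hp]
  obtain ⟨s, hs, hlt⟩ := exists_lt_of_lt_csSup ⟨_, hS⟩
    (show sSup S / (q / p) < sSup S from div_lt_self (by linarith) hq)
  have hs0 : 0 < s := lt_trans (by positivity) hlt
  refine ⟨s, hs0, fun ζ => ?_⟩
  have hinv : ∀ a : ℝ, ∫⁻ ξ : unitSphere n, ‖1 - inner ℂ (ζ : Cn n) (ξ : Cn n)‖ₑ ^ a ∂(sigma n) =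
      ∫⁻ ξ : unitSphere n, ‖1 - inner ℂ (e : Cn n) (ξ : Cn n)‖ₑ ^ a ∂(sigma n) := fun a =>
    lintegral_inner_eq (F := fun w => ‖1 - w‖ₑ ^ a)
      ((Continuous.measurable (by fun_prop)).pow_const a) ζ e
  rw [hinv, hinv]
  refine ⟨hs, ?_⟩
  by_contra h
  have h1 : s * (q / p) ≤ sSup S := le_csSup hbdd (lt_top_iff_ne_top.2 h)
  rw [div_lt_iff₀ (by linarith)] at hlt
  linarith

/-! ### The test functions and their Hardy norms. -/

/-- The test function `z ↦ (1 - r⟨ζ, z⟩)⁻ᵃ`. -/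
noncomputable def kernelPower {n : ℕ} (a r : ℝ) (ζ : Cn n) (z : Cn n) : ℂ :=
  (1 - r * inner ℂ ζ z) ^ ((-a : ℝ) : ℂ)

theorem norm_mul_inner_lt_one {n : ℕ} {r : ℝ} (hr : r ∈ Ioo (0 : ℝ) 1) {ζ z : Cn n}
    (hζ : ‖ζ‖ ≤ 1) (hz : ‖z‖ ≤ 1) : ‖(r : ℂ) * inner ℂ ζ z‖ < 1 := by
  have h1 := norm_inner_le_norm (𝕜 := ℂ) ζ z
  have h2 : ‖ζ‖ * ‖z‖ ≤ 1 := mul_le_one₀ hζ (norm_nonneg _) hz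
  rw [norm_mul, Complex.norm_real, Real.norm_of_nonneg hr.1.le]
  nlinarith [hr.1, hr.2, norm_nonneg (inner ℂ ζ z)]

theorem one_sub_mul_inner_mem_slitPlane {n : ℕ} {r : ℝ} (hr : r ∈ Ioo (0 : ℝ) 1) {ζ z : Cn n}
    (hζ : ‖ζ‖ ≤ 1) (hz : ‖z‖ ≤ 1) : 1 - (r : ℂ) * inner ℂ ζ z ∈ Complex.slitPlane := by
  refine Or.inl ?_
  have h1 := (Complex.re_le_norm ((r : ℂ) * inner ℂ ζ z)).trans_lt (norm_mul_inner_lt_one hr hζ hz)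
  rw [Complex.sub_re, Complex.one_re]
  linarith

/-- As `r < 1`, the base stays in the right half-plane on the whole closed ball. Differentiability
at boundary points lets boundary values be taken by continuity. -/
theorem differentiableAt_kernelPower {n : ℕ} (a : ℝ) {r : ℝ} (hr : r ∈ Ioo (0 : ℝ) 1)
    {ζ z : Cn n} (hζ : ‖ζ‖ ≤ 1) (hz : ‖z‖ ≤ 1) : DifferentiableAt ℂ (kernelPower a r ζ) z := by
  refine DifferentiableAt.cpow ?_ (differentiableAt_const _)
    (one_sub_mul_inner_mem_slitPlane hr hζ hz)
  have : DifferentiableAt ℂ (fun z : Cn n => inner ℂ ζ z) z :=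
    (innerSL ℂ ζ).differentiableAt
  exact (differentiableAt_const _).sub ((differentiableAt_const _).mul this)

theorem enorm_kernelPower {n : ℕ} (a : ℝ) {r : ℝ} (hr : r ∈ Ioo (0 : ℝ) 1)
    {ζ z : Cn n} (hζ : ‖ζ‖ ≤ 1) (hz : ‖z‖ ≤ 1) :
    ‖kernelPower a r ζ z‖ₑ = ‖1 - r * inner ℂ ζ z‖ₑ ^ (-a) := by
  have h0 : 0 < ‖1 - r * inner ℂ ζ z‖ :=
    norm_pos_iff.2 (Complex.slitPlane_ne_zero (one_sub_mul_inner_mem_slitPlane hr hζ hz))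
  rw [kernelPower, ← ofReal_norm, Complex.norm_cpow_real, ← ofReal_norm,
    ENNReal.ofReal_rpow_of_pos h0]

/-- The moduli `|1 - rw|` of the dilations are comparable from below to `|1 - w|`. -/
theorem norm_one_sub_le_two_mul {r : ℝ} (hr : r ∈ Ioo (0 : ℝ) 1) {w : ℂ} (hw : ‖w‖ ≤ 1) :
    ‖1 - w‖ ≤ 2 * ‖1 - r * w‖ := by
  have h1 : ‖1 - w‖ ≤ ‖1 - r * w‖ + ‖((1 - r : ℝ) : ℂ) * w‖ := by
    refine le_trans (le_of_eq ?_) (norm_sub_le _ _)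
    congr 1
    push_cast
    ring
  have h2 : ‖((1 - r : ℝ) : ℂ) * w‖ ≤ 1 - r := by
    rw [norm_mul, Complex.norm_real, Real.norm_of_nonneg (by linarith [hr.2])]
    exact mul_le_of_le_one_right (by linarith [hr.2]) hw
  have h3 : 1 - r ≤ ‖1 - r * w‖ := by
    have := norm_sub_norm_le (1 : ℂ) (r * w)
    rw [norm_one, norm_mul, Complex.norm_real, Real.norm_of_nonneg hr.1.le] at this
    nlinarith [hr.1]
  linarith

/-- On the sphere of radius `ρ`, `|1 - ⟨ζ, ξ⟩| ≤ 2|1 - rρ⟨ζ, ξ⟩|`. The bound is thus free of both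
`r` and `ρ`. -/
theorem hardyNorm_kernelPower_le {n : ℕ} {p a r : ℝ} (hp : 0 < p) (ha : 0 < a)
    (hr : r ∈ Ioo (0 : ℝ) 1) (ζ : unitSphere n) :
    hardyNorm p (kernelPower a r (ζ : Cn n)) ≤ (2 ^ (a * p) *
      ∫⁻ ξ : unitSphere n, ‖1 - inner ℂ (ζ : Cn n) (ξ : Cn n)‖ₑ ^ (-(a * p)) ∂(sigma n)) ^
        (1 / p) := by
  have hζ : ‖(ζ : Cn n)‖ = 1 := by simp
  refine ENNReal.rpow_le_rpow (iSup₂_le fun ρ hρ => ?_) (by positivity)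
  rw [← lintegral_const_mul _ (measurable_enorm_one_sub_inner_rpow _ _)]
  refine lintegral_mono fun ξ => ?_
  have hξ : ‖(ξ : Cn n)‖ = 1 := by simp
  have hρξ : ‖ρ • (ξ : Cn n)‖ ≤ 1 := by
    rw [norm_smul, hξ, Real.norm_of_nonneg hρ.1.le, mul_one]; exact hρ.2.le
  rw [enorm_kernelPower a hr hζ.le hρξ, ← ENNReal.rpow_mul, neg_mul]
  have h1 : inner ℂ (ζ : Cn n) (ρ • (ξ : Cn n)) = (ρ : ℂ) * inner ℂ (ζ : Cn n) (ξ : Cn n) := by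
    rw [← inner_smul_right]; rfl
  have h2 : ‖inner ℂ (ζ : Cn n) (ξ : Cn n)‖ ≤ 1 := by
    simpa [hζ, hξ] using norm_inner_le_norm (𝕜 := ℂ) (ζ : Cn n) (ξ : Cn n)
  have h3 := norm_one_sub_le_two_mul (r := r * ρ)
    ⟨mul_pos hr.1 hρ.1, mul_lt_one_of_nonneg_of_lt_one_left hr.1.le hr.2 hρ.2.le⟩ h2
  rw [Complex.ofReal_mul, mul_assoc] at h3
  have h4 : ‖1 - inner ℂ (ζ : Cn n) (ξ : Cn n)‖ₑ ≤
      2 * ‖1 - (r : ℂ) * (ρ * inner ℂ (ζ : Cn n) (ξ : Cn n))‖ₑ := by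
    rw [← ofReal_norm, ← ofReal_norm]
    refine (ENNReal.ofReal_le_ofReal h3).trans (le_of_eq ?_)
    rw [ENNReal.ofReal_mul (by norm_num)]
    simp
  have hap : 0 < a * p := mul_pos ha hp
  rw [h1, ENNReal.rpow_neg, ENNReal.rpow_neg, ← div_eq_mul_inv]
  rw [ENNReal.le_div_iff_mul_le (Or.inr (by simp [hap])) (Or.inr (by simp [hap]))]
  rw [mul_comm, ← div_eq_mul_inv]
  refine ENNReal.div_le_of_le_mul ?_
  rw [← ENNReal.mul_rpow_of_nonneg _ _ hap.le]
  exact ENNReal.rpow_le_rpow h4 hap.le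

/-! ### Boundary estimate and averaging over the sphere. -/

/-- Since missing limits get the value 0, a nonzero value certifies that the limit exists. No
theorem on almost everywhere existence of radial limits is therefore required. -/
theorem tendsto_radialLimit {n : ℕ} {F : Type} [TopologicalSpace F] [Zero F] {f : Cn n → F}
    {ξ : unitSphere n} (h : radialLimit f ξ ≠ 0) :
    Tendsto (fun r : ℝ => f (r • (ξ : Cn n))) (𝓝[<] 1) (𝓝 (radialLimit f ξ)) := by
  classical
  unfold radialLimit at h ⊢
  split_ifs at h ⊢ with hex
  · exact hex.choose_spec
  · exact (h rfl).elim

/-- Boundary form of the Hardy norm estimate, for test functions continuous up to the sphere. -/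
theorem lintegral_extremeSet_le {n : ℕ} {q : ℝ} (hq : 0 < q) {ψ f : Cn n → ℂ} {φ : Cn n → Cn n}
    (hψ : ContinuousOn ψ (unitBall n)) (hφ : ContinuousOn φ (unitBall n))
    (hφ_maps : MapsTo φ (unitBall n) (unitBall n))
    (hf : ∀ z : Cn n, ‖z‖ ≤ 1 → ContinuousAt f z) :
    ∫⁻ ξ in extremeSet φ, ‖radialLimit ψ ξ‖ₑ ^ q * ‖f (radialLimit φ ξ)‖ₑ ^ q ∂(sigma n) ≤
      hardyNorm q (weightedComp ψ φ f) ^ q := by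
  have hball : ∀ (ξ : unitSphere n) (r : ℝ), r ∈ Ioo (0 : ℝ) 1 → r • (ξ : Cn n) ∈ unitBall n := by
    intro ξ r hr
    simpa [norm_smul, abs_of_pos hr.1] using hr.2
  obtain ⟨u, -, hu, hlim⟩ := exists_seq_strictMono_tendsto' (show (0 : ℝ) < 1 by norm_num)
  have hlim' : Tendsto u atTop (𝓝[<] 1) :=
    tendsto_nhdsWithin_iff.2 ⟨hlim, Eventually.of_forall fun k => (hu k).2⟩
  have hcont : ContinuousOn (weightedComp ψ φ f) (unitBall n) := by
    refine hψ.mul (ContinuousOn.comp (t := unitBall n) (fun z hz => ?_) hφ hφ_maps)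
    exact (hf z (by simpa using (mem_ball_zero_iff.1 hz).le)).continuousWithinAt
  have hmeas : ∀ k, Measurable fun ξ : unitSphere n =>
      ‖weightedComp ψ φ f (u k • (ξ : Cn n))‖ₑ ^ q := by
    intro k
    have : Continuous fun ξ : unitSphere n => weightedComp ψ φ f (u k • (ξ : Cn n)) :=
      hcont.comp_continuous (by fun_prop) fun ξ => hball ξ _ (hu k)
    exact this.enorm.measurable.pow_const q
  have hE : MeasurableSet (extremeSet φ) :=
    (measurable_radialLimit hφ).norm (measurableSet_singleton 1)
  calc _ ≤ ∫⁻ ξ in extremeSet φ,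
        liminf (fun k => ‖weightedComp ψ φ f (u k • (ξ : Cn n))‖ₑ ^ q) atTop ∂(sigma n) := by
        refine setLIntegral_mono' hE fun ξ hξ => ?_
        -- Where `ψ* = 0`, limit or not, the left side vanishes because `q > 0`. Elsewhere both
        -- limits exist, as `|φ*| = 1` on `E`.
        by_cases hψ0 : radialLimit ψ ξ = 0
        · simp [hψ0, hq]
        have hξ1 : ‖radialLimit φ ξ‖ = 1 := hξ
        have hφ0 : radialLimit φ ξ ≠ 0 := fun h => by simp [h] at hξ1
        have t1 := (tendsto_radialLimit hψ0).comp hlim'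
        have t2 := (hf _ hξ1.le).tendsto.comp ((tendsto_radialLimit hφ0).comp hlim')
        have t3 := ((ENNReal.continuous_rpow_const (y := q)).tendsto _).comp
          ((t1.mul t2).enorm)
        refine le_of_eq ?_
        rw [← ENNReal.mul_rpow_of_nonneg _ _ hq.le, ← enorm_mul]
        exact t3.liminf_eq.symm
    _ ≤ ∫⁻ ξ, liminf (fun k => ‖weightedComp ψ φ f (u k • (ξ : Cn n))‖ₑ ^ q) atTop ∂(sigma n) :=
        setLIntegral_le_lintegral _ _
    _ ≤ liminf (fun k => ∫⁻ ξ : unitSphere n,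
          ‖weightedComp ψ φ f (u k • (ξ : Cn n))‖ₑ ^ q ∂(sigma n)) atTop :=
        lintegral_liminf_le hmeas
    _ ≤ hardyNorm q (weightedComp ψ φ f) ^ q := by
        rw [hardyNorm, ← ENNReal.rpow_mul, one_div_mul_cancel hq.ne', ENNReal.rpow_one]
        refine liminf_le_of_frequently_le' (Frequently.of_forall fun k => ?_)
        exact le_iSup₂ (f := fun r (_ : r ∈ Ioo (0 : ℝ) 1) => ∫⁻ ξ : unitSphere n,
          ‖weightedComp ψ φ f (r • (ξ : Cn n))‖ₑ ^ q ∂(sigma n)) (u k) (hu k)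

/-- Averaging the boundary estimate over a rotation orbit of test functions. -/
theorem lintegral_mul_lintegral_kernelPower_le {n : ℕ} [NeZero n] {q a r : ℝ} (hq : 0 < q)
    (hr : r ∈ Ioo (0 : ℝ) 1) {ψ : Cn n → ℂ} {φ : Cn n → Cn n}
    (hψ : ContinuousOn ψ (unitBall n)) (hφ : ContinuousOn φ (unitBall n))
    (hφ_maps : MapsTo φ (unitBall n) (unitBall n)) {K : ℝ≥0∞}
    (hK : ∀ ζ : unitSphere n,
      hardyNorm q (weightedComp ψ φ (kernelPower a r (ζ : Cn n))) ^ q ≤ K) (η : unitSphere n) :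
    (∫⁻ ξ in extremeSet φ, ‖radialLimit ψ ξ‖ₑ ^ q ∂(sigma n)) *
      ∫⁻ ζ : unitSphere n, ‖1 - r * inner ℂ (η : Cn n) (ζ : Cn n)‖ₑ ^ (-(a * q)) ∂(sigma n) ≤
        K * sigma n univ := by
  have hφm : Measurable (radialLimit φ) := measurable_radialLimit hφ
  have hψm : Measurable (radialLimit ψ) := measurable_radialLimit hψ
  have hE : MeasurableSet (extremeSet φ) := hφm.norm (measurableSet_singleton 1)
  set B := ∫⁻ ζ : unitSphere n, ‖1 - r * inner ℂ (η : Cn n) (ζ : Cn n)‖ₑ ^ (-(a * q)) ∂(sigma n)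
  -- Only here does `|φ*(ξ)| = 1` enter as a point of the sphere: rotation invariance replaces it by
  -- `η`. Conjugation exchanges the two slots of the inner product.
  have hB : ∀ ξ ∈ extremeSet φ, ∫⁻ ζ : unitSphere n,
      ‖1 - r * inner ℂ (ζ : Cn n) (radialLimit φ ξ)‖ₑ ^ (-(a * q)) ∂(sigma n) = B := by
    intro ξ hξ
    have h1 := lintegral_inner_eq (F := fun w => ‖1 - r * w‖ₑ ^ (-(a * q)))
      ((Continuous.measurable (by fun_prop)).pow_const _)
      ⟨radialLimit φ ξ, mem_sphere_zero_iff_norm.2 hξ⟩ η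
    refine Eq.trans (lintegral_congr fun ζ => ?_) h1
    congr 1
    rw [← inner_conj_symm (ζ : Cn n), ← RCLike.enorm_conj]
    simp
  have hmeas : Measurable (Function.uncurry fun (ξ ζ : unitSphere n) =>
      ‖radialLimit ψ ξ‖ₑ ^ q *
        ‖1 - r * inner ℂ (ζ : Cn n) (radialLimit φ ξ)‖ₑ ^ (-(a * q))) := by
    refine Measurable.mul ?_ ?_
    · exact (hψm.comp measurable_fst).enorm.pow_const q
    · have h2 : Measurable fun x : unitSphere n × unitSphere n =>
          inner ℂ (x.2 : Cn n) (radialLimit φ x.1) :=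
        Measurable.inner (measurable_subtype_coe.comp measurable_snd) (hφm.comp measurable_fst)
      exact (measurable_const.sub (measurable_const.mul h2)).enorm.pow_const _
  calc (∫⁻ ξ in extremeSet φ, ‖radialLimit ψ ξ‖ₑ ^ q ∂(sigma n)) * B
      = ∫⁻ ξ in extremeSet φ, ∫⁻ ζ : unitSphere n, ‖radialLimit ψ ξ‖ₑ ^ q *
          ‖1 - r * inner ℂ (ζ : Cn n) (radialLimit φ ξ)‖ₑ ^ (-(a * q)) ∂(sigma n) ∂(sigma n) := by
        rw [← lintegral_mul_const _ (hψm.enorm.pow_const q)]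
        refine setLIntegral_congr_fun hE fun ξ hξ => ?_
        rw [← hB ξ hξ, lintegral_const_mul]
        refine Measurable.pow_const (Continuous.measurable ?_) _
        fun_prop
    _ = ∫⁻ ζ : unitSphere n, ∫⁻ ξ in extremeSet φ, ‖radialLimit ψ ξ‖ₑ ^ q *
          ‖1 - r * inner ℂ (ζ : Cn n) (radialLimit φ ξ)‖ₑ ^ (-(a * q)) ∂(sigma n) ∂(sigma n) :=
        lintegral_lintegral_swap hmeas.aemeasurable
    _ ≤ ∫⁻ ζ : unitSphere n, K ∂(sigma n) := by
        refine lintegral_mono fun ζ => ?_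
        have hζ : ‖(ζ : Cn n)‖ = 1 := by simp
        refine le_trans (le_of_eq ?_) ((lintegral_extremeSet_le hq hψ hφ hφ_maps fun z hz =>
          (differentiableAt_kernelPower a hr hζ.le hz).continuousAt).trans (hK ζ))
        refine setLIntegral_congr_fun hE fun ξ hξ => ?_
        have hξ1 : ‖radialLimit φ ξ‖ = 1 := hξ
        rw [enorm_kernelPower a hr hζ.le hξ1.le, ← ENNReal.rpow_mul, neg_mul]
    _ = K * sigma n univ := lintegral_const _

/-! ### Vanishing of the weight on the extreme set. -/

/-- The weight of a bounded weighted composition operator from `H^p` to `H^q`, `p < q`, vanishes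
almost everywhere on the extreme set. -/
theorem lintegral_extremeSet_eq_zero {n : ℕ} [NeZero n] {p q : ℝ} (hp : 0 < p) (hpq : p < q)
    {ψ : Cn n → ℂ} {φ : Cn n → Cn n}
    (hψ : ContinuousOn ψ (unitBall n)) (hφ : ContinuousOn φ (unitBall n))
    (hφ_maps : MapsTo φ (unitBall n) (unitBall n)) (hW : IsBoundedWeightedComp p q ψ φ) :
    ∫⁻ ξ in extremeSet φ, ‖radialLimit ψ ξ‖ₑ ^ q ∂(sigma n) = 0 := by
  have hq : 0 < q := hp.trans hpq
  obtain ⟨s, hs, hcrit⟩ := exists_critical_exponent n hp hpq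
  obtain ⟨-, C, hC⟩ := hW
  let e : unitSphere n := ⟨EuclideanSpace.single 0 1, by simp⟩
  set A := ∫⁻ ξ : unitSphere n, ‖1 - inner ℂ (e : Cn n) (ξ : Cn n)‖ₑ ^ (-s) ∂(sigma n)
  have hA : ∀ ζ : unitSphere n,
      ∫⁻ ξ : unitSphere n, ‖1 - inner ℂ (ζ : Cn n) (ξ : Cn n)‖ₑ ^ (-s) ∂(sigma n) = A := fun ζ =>
    lintegral_inner_eq (F := fun w => ‖1 - w‖ₑ ^ (-s))
      ((Continuous.measurable (by fun_prop)).pow_const _) ζ e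
  have hsp : s / p * p = s := div_mul_cancel₀ s hp.ne'
  set D : ℝ≥0∞ := (2 ^ s * A) ^ (1 / p)
  have hD : D < ∞ := by
    refine ENNReal.rpow_lt_top_of_nonneg (by positivity) (ENNReal.mul_lt_top ?_ (hcrit e).1).ne
    exact ENNReal.rpow_lt_top_of_nonneg hs.le (by norm_num)
  have hK : ∀ r ∈ Ioo (0 : ℝ) 1, ∀ ζ : unitSphere n,
      hardyNorm q (weightedComp ψ φ (kernelPower (s / p) r (ζ : Cn n))) ^ q ≤ (C * D) ^ q := by
    intro r hr ζ
    have hζ : ‖(ζ : Cn n)‖ = 1 := by simp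
    have h1 := hardyNorm_kernelPower_le hp (div_pos hs hp) hr ζ
    rw [hsp, hA] at h1
    refine ENNReal.rpow_le_rpow ((hC _ ⟨fun z hz => ?_, h1.trans_lt hD⟩).trans ?_) hq.le
    · exact (differentiableAt_kernelPower _ hr hζ.le
        (mem_ball_zero_iff.1 hz).le).differentiableWithinAt
    · gcongr
  set M := ∫⁻ ξ in extremeSet φ, ‖radialLimit ψ ξ‖ₑ ^ q ∂(sigma n)
  obtain ⟨u, -, hu, hlim⟩ := exists_seq_strictMono_tendsto' (show (0 : ℝ) < 1 by norm_num)
  set L : ℝ≥0∞ := (C * D) ^ q * sigma n univ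
  have hL : L < ∞ := ENNReal.mul_lt_top
    (ENNReal.rpow_lt_top_of_nonneg hq.le (ENNReal.mul_lt_top (by simp) hD).ne) (measure_lt_top _ _)
  have hbound : ∀ k, M * ∫⁻ ζ : unitSphere n,
      ‖1 - u k * inner ℂ (e : Cn n) (ζ : Cn n)‖ₑ ^ (-(s / p * q)) ∂(sigma n) ≤ L := fun k =>
    lintegral_mul_lintegral_kernelPower_le hq (hu k) hψ hφ hφ_maps (hK _ (hu k)) e
  by_contra hM
  -- `M = ∞` is not excluded at this point; the division is legitimate because `M ≠ 0` and `L` is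
  -- finite.
  have hbound' : ∀ k, ∫⁻ ζ : unitSphere n,
      ‖1 - u k * inner ℂ (e : Cn n) (ζ : Cn n)‖ₑ ^ (-(s / p * q)) ∂(sigma n) ≤ L / M := fun k => by
    rw [ENNReal.le_div_iff_mul_le (Or.inl hM) (Or.inr hL.ne), mul_comm]
    exact hbound k
  have hfatou : ∫⁻ ζ : unitSphere n,
      ‖1 - inner ℂ (e : Cn n) (ζ : Cn n)‖ₑ ^ (-(s / p * q)) ∂(sigma n) ≤ L / M := by
    calc _ = ∫⁻ ζ : unitSphere n, liminf (fun k =>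
          ‖1 - u k * inner ℂ (e : Cn n) (ζ : Cn n)‖ₑ ^ (-(s / p * q))) atTop ∂(sigma n) := by
          refine lintegral_congr fun ζ => ?_
          have hc : Continuous fun t : ℝ =>
              ‖1 - t * inner ℂ (e : Cn n) (ζ : Cn n)‖ₑ ^ (-(s / p * q)) :=
            ENNReal.continuous_rpow_const.comp (by fun_prop)
          have := (hc.tendsto 1).comp hlim
          simpa [Function.comp_def] using this.liminf_eq.symm
      _ ≤ liminf (fun k => ∫⁻ ζ : unitSphere n,
          ‖1 - u k * inner ℂ (e : Cn n) (ζ : Cn n)‖ₑ ^ (-(s / p * q)) ∂(sigma n)) atTop :=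
          lintegral_liminf_le fun k => (Continuous.measurable (by fun_prop)).pow_const _
      _ ≤ L / M := liminf_le_of_frequently_le' (Frequently.of_forall hbound')
  have h1 := (hcrit e).2
  rw [show s * (q / p) = s / p * q by ring] at h1
  rw [h1] at hfatou
  exact absurd (top_le_iff.1 hfatou) (ENNReal.div_ne_top hL.ne hM)

end HardyBall

theorem corollary6p1 (n : ℕ) (hn : 1 ≤ n) (p q : ℝ) (hp : 0 < p) (hpq : p < q)
    (ψ : HardyBall.Cn n → ℂ) (φ : HardyBall.Cn n → HardyBall.Cn n)
    (hψ : DifferentiableOn ℂ ψ (HardyBall.unitBall n))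
    (hφ : DifferentiableOn ℂ φ (HardyBall.unitBall n))
    (hφ_maps : Set.MapsTo φ (HardyBall.unitBall n) (HardyBall.unitBall n))
    (hW : HardyBall.IsBoundedWeightedComp p q ψ φ) :
    HardyBall.pullbackMeasure ψ φ q (HardyBall.radialLimit φ '' HardyBall.extremeSet φ) = 0 := by
  have : NeZero n := ⟨by omega⟩
  -- The image `φ*(E)` is not known to be Borel, so it is enlarged to the sphere, whose preimage
  -- under `φ*` is exactly `E`.
  refine measure_mono_null (t := HardyBall.unitSphere n) ?_ ?_
  · rintro _ ⟨ξ, hξ, rfl⟩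
    exact mem_sphere_zero_iff_norm.2 hξ
  · rw [HardyBall.pullbackMeasure_apply q hφ.continuousOn isClosed_sphere.measurableSet]
    have : HardyBall.radialLimit φ ⁻¹' HardyBall.unitSphere n = HardyBall.extremeSet φ := by
      ext ξ
      exact mem_sphere_zero_iff_norm
    rw [this]
    exact HardyBall.lintegral_extremeSet_eq_zero hp hpq hψ.continuousOn hφ.continuousOn hφ_maps hW
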